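/- Conventions. Algorithms are (partial) recursive functions acting on numbers of finite objects, with respect to fixed effective numberings of the rationals, the positive rationals, pairs and finite lists. A family of objects is computable "uniformly in $i$" if a single algorithm, taking $i$ as an additional input, computes all of them. A computable metric space (CMS) is a metric space $(X,d)$ with a dense sequence $(s_i)_{i\in\mathbb N}$ of points (the ideal points) such that there is an algorithm $A:\mathbb N^3\to\mathbb Q$ with $|A(i,j,n)-d(s_i,s_j)|\le 2^{-n}$ for all $i,j,n$. A point $x\in X$ is computable if there is a total computable $f:\mathbb N\to\mathbb N$ with $d(s_{f(n)},x)\le 2^{-n}$ for all $n$. The ideal balls are the open balls $B(s_i,q)$ with $q\in\mathbb Q_{>0}$, numbered effectively by the pair $(i,q)$. A family $(U_j)_j$ of open sets is uniformly constructive if there is a (possibly partial) algorithm which on input $(j,n)$ outputs, when it halts, an ideal ball $B_{j,n}$, such that for every $j$ the set $U_j$ is the union of the $B_{j,n}$ over those $n$ for which the algorithm halts on $(j,n)$. A Borel probability measure $\mu$ on $X$ is computable if there is a total algorithm enumerating probability measures $\mu_0,\mu_1,\dots$, each of them concentrated on finitely many ideal points, with rational weights (given as a finite list of ideal points with weights),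 such that $\rho(\mu_n,\mu)\le 2^{-n}$ for all $n$, where $\rho$ is the Prokhorov metric. A family $(R_i)_{i\in\mathbb N}$ of subsets of $X$ is a uniform family of constructive Borel–Cantelli sets if there are open sets $U^i_n$ $(i,n\in\mathbb N)$, constructive uniformly in $(i,n)$, such that $R_i=\bigcup_k\bigcap_{n\ge k}U^i_n$ for every $i$, and the sequences $(\mu(X\setminus U^i_n))_n$ are effectively summable uniformly in $i$: there is a total algorithm $A:\mathbb N\times\mathbb Q_{>0}\to\mathbb N$ with $\sum_{n\ge A(i,\varepsilon)}\mu(X\setminus U^i_n)\le\varepsilon$ for all $i$ and all $\varepsilon\in\mathbb Q_{>0}$. Statement. Let $X$ be a complete CMS and let $\mu$ be a computable Borel probability measure on $X$. For every uniform family $(R_i)_{i\in\mathbb N}$ of constructive Borel–Cantelli sets, the set of computable points lying in $\bigcap_i R_i$ is dense in the support of $\mu$; that is, every non-empty relatively open subset of $\operatorname{supp}\mu$ contains a computable point lying in $\bigcap_i R_i$. -/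

import Mathlib

open MeasureTheory Set
open scoped ENNReal

namespace CompMetric

noncomputable section

/-! ### Numberings of the rationals

Algorithms are (partial) recursive functions acting on numbers of finite objects.  The numberings
below are effective: the number of a rational can be computed from a fraction representing it and
vice versa, and equality of the numbered rationals is decidable. -/

/-- The rational with number `n = ⟨⟨a, b⟩, c⟩` is `(a - b) / (c + 1)`. -/
def rat (n : ℕ) : ℚ :=
  ((n.unpair.1.unpair.1 : ℚ) - (n.unpair.1.unpair.2 : ℚ)) / ((n.unpair.2 : ℚ) + 1)

/-- The positive rational with number `n = ⟨a, c⟩` is `(a + 1) / (c + 1)`. -/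
def posRat (n : ℕ) : ℚ := ((n.unpair.1 : ℚ) + 1) / ((n.unpair.2 : ℚ) + 1)

theorem rat_surjective : Function.Surjective rat := by
  intro q
  refine ⟨Nat.pair (Nat.pair q.num.toNat (-q.num).toNat) (q.den - 1), ?_⟩
  have hd : ((q.den - 1 : ℕ) : ℚ) + 1 = q.den := by
    have := q.den_pos
    exact_mod_cast Nat.sub_add_cancel this
  have hn : ((q.num.toNat : ℚ) - ((-q.num).toNat : ℚ)) = q.num := by
    have h : ((q.num.toNat : ℤ) - ((-q.num).toNat : ℤ)) = q.num := by omega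
    exact_mod_cast h
  simp only [rat, Nat.unpair_pair, hd, hn]
  exact Rat.num_div_den q

theorem posRat_pos (n : ℕ) : 0 < posRat n := by
  unfold posRat
  positivity

theorem exists_posRat_eq {q : ℚ} (hq : 0 < q) : ∃ n, posRat n = q := by
  refine ⟨Nat.pair (q.num.toNat - 1) (q.den - 1), ?_⟩
  have hd : ((q.den - 1 : ℕ) : ℚ) + 1 = q.den := by
    have := q.den_pos
    exact_mod_cast Nat.sub_add_cancel this
  have hn : ((q.num.toNat - 1 : ℕ) : ℚ) + 1 = q.num := by
    have h0 : 0 < q.num := Rat.num_pos.mpr hq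
    have h : ((q.num.toNat - 1 : ℕ) : ℤ) + 1 = q.num := by omega
    exact_mod_cast h
  simp only [posRat, Nat.unpair_pair, hd, hn]
  exact Rat.num_div_den q

/-- A family of reals is computable uniformly in its index: one algorithm outputs, on input `i` and
`n`, a rational at distance at most `2⁻ⁿ` from `x i`. -/
def UniformlyComputableReal {ι : Type*} [Primcodable ι] (x : ι → ℝ) : Prop :=
  ∃ A : ι → ℕ → ℕ, Computable₂ A ∧ ∀ i n, |(rat (A i n) : ℝ) - x i| ≤ (1 / 2 : ℝ) ^ n

/-- A family (indexed by `i`) of sequences of nonnegative numbers is effectively summable, uniformly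
in `i`: one algorithm computes, from `i` and a positive rational `ε`, an `m` such that
`∑_{k ≥ m} a i k ≤ ε`.  The sums are taken in `[0, ∞]`. -/
def UniformlyEffectivelySummable {ι : Type*} [Primcodable ι] (a : ι → ℕ → ℝ≥0∞) : Prop :=
  ∃ A : ι → ℕ → ℕ, Computable₂ A ∧
    ∀ i e, ∑' k, a i (A i e + k) ≤ ENNReal.ofReal (posRat e : ℝ)

/-! ### Computable metric spaces -/

section Metric

variable {X : Type*} [MetricSpace X]

/-- `(X, d, s)` is a computable metric space with sequence of ideal points `s`. -/
structure IsComputableMetricSpace (s : ℕ → X) : Prop where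
  dense : DenseRange s
  dist_computable : UniformlyComputableReal (fun p : ℕ × ℕ => dist (s p.1) (s p.2))

/-- `x` is a computable point: an algorithm enumerates ideal points converging fast to `x`. -/
def IsComputablePoint (s : ℕ → X) (x : X) : Prop :=
  ∃ f : ℕ → ℕ, Computable f ∧ ∀ n, dist (s (f n)) x ≤ (1 / 2 : ℝ) ^ n

/-- The ideal ball with number `⟨i, j⟩`: the open ball around `s i` whose radius is the
positive rational with number `j`. -/
def idealBall (s : ℕ → X) (b : ℕ) : Set X :=
  Metric.ball (s b.unpair.1) (posRat b.unpair.2 : ℝ)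

/-- The sets `U i` are constructive open uniformly in `i`: one (possibly partial) algorithm
`φ` enumerates, for each `i`, ideal balls `φ i 0, φ i 1, …` whose union is `U i`; inputs
on which it diverges contribute nothing. -/
def UniformlyConstructiveOpen (s : ℕ → X) {ι : Type*} [Primcodable ι] (U : ι → Set X) : Prop :=
  ∃ φ : ι → ℕ →. ℕ, Partrec₂ φ ∧ ∀ i, U i = ⋃ (n : ℕ), ⋃ b ∈ φ i n, idealBall s b

end Metric

/-! ### Computable measures and constructive Borel-Cantelli sets -/

section Measure

variable {X : Type*} [MetricSpace X] [MeasurableSpace X]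

/-- A finite list of pairs (number of an ideal point, number of a rational weight) names an
ideal measure if the weights are nonnegative and add up to `1`. -/
def IsIdealMeasureName (l : List (ℕ × ℕ)) : Prop :=
  (∀ p ∈ l, 0 ≤ rat p.2) ∧ (l.map fun p => rat p.2).sum = 1

/-- The measure giving the listed ideal points the listed weights. -/
def idealMeasure (s : ℕ → X) (l : List (ℕ × ℕ)) : Measure X :=
  (l.map fun p => ENNReal.ofReal (rat p.2 : ℝ) • Measure.dirac (s p.1)).sum

/-- `μ` is a computable (probability) measure: an algorithm enumerates ideal probability measures
converging fast to `μ` in the Prokhorov metric. -/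
def IsComputableMeasure (s : ℕ → X) (μ : Measure X) : Prop :=
  ∃ F : ℕ → List (ℕ × ℕ), Computable F ∧
    ∀ n, IsIdealMeasureName (F n) ∧
      levyProkhorovEDist (idealMeasure s (F n)) μ ≤ (2⁻¹ : ℝ≥0∞) ^ n

/-- The sequences `(U i n)ₙ` are constructive Borel-Cantelli sequences, uniformly in `i`. -/
structure UniformBorelCantelliSequences (s : ℕ → X) (μ : Measure X)
    {ι : Type*} [Primcodable ι] (U : ι → ℕ → Set X) : Prop where
  constructive_open : UniformlyConstructiveOpen s (fun p : ι × ℕ => U p.1 p.2)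
  summable_compl : UniformlyEffectivelySummable (fun i n => μ (U i n)ᶜ)

/-- The sets `R i` are constructive Borel-Cantelli sets, uniformly in `i`. -/
def UniformBorelCantelliSets (s : ℕ → X) (μ : Measure X)
    {ι : Type*} [Primcodable ι] (R : ι → Set X) : Prop :=
  ∃ U : ι → ℕ → Set X, UniformBorelCantelliSequences s μ U ∧
    ∀ i, R i = ⋃ (k : ℕ), ⋂ (n : ℕ) (_ : k ≤ n), U i n

end Measure

end

end CompMetric

/-! An ideal ball `B` close to a given point of the support has positive measure. Cutting each
sequence `U i` at a computable index, so that all the removed complements together have measure less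
than `μ B`, and arranging the remaining open sets in one sequence `G j`, gives an intersection
contained in every `R i` that meets `B` in positive measure.

The key point is that positivity of the measure of `B' ∩ ⋂ G j` is semidecidable in `B'`
(`exists_certificate_iff`), although the intersection is not open. The measure of a finite
intersection of constructive open sets can be bounded from below by the Prokhorov approximations
(`lt_measure_of_lt_weightOn`, `exists_lt_weightOn_of_lt_measure`), and summability bounds
effectively what the remaining `G j` remove (`measure_tail_flattenTails_le`).

Unbounded search then produces nested balls of positive measure in `⋂ G j`, the `n`-th step entering
`G n` and shrinking the radius below `2⁻ⁿ` (`exists_computablePoint_mem_iInter`). Countably many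
such refinements cover `B' ∩ ⋂ G j`, so one of them has positive measure and the search never fails.
The limit is computable, lies in every `G j`, and lies in the support because all the balls have
positive measure. -/

namespace CompMetric

/-! ### Semidecidable predicates -/

section SemiDec

variable {α β : Type*} [Primcodable α] [Primcodable β]

/-- A predicate is semidecidable if it is the projection of a primitive recursive relation. -/
def SemiDec (P : α → Prop) : Prop :=
  ∃ R : α → ℕ → Prop, PrimrecRel R ∧ ∀ a, P a ↔ ∃ n, R a n

theorem SemiDec.of_eq {P Q : α → Prop} (hP : SemiDec P) (h : ∀ a, P a ↔ Q a) : SemiDec Q := by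
  obtain ⟨R, hR, hPR⟩ := hP
  exact ⟨R, hR, fun a => (h a).symm.trans (hPR a)⟩

theorem _root_.PrimrecPred.semiDec {P : α → Prop} (hP : PrimrecPred P) : SemiDec P :=
  ⟨fun a _ => P a, hP.comp Primrec.fst, fun a => by simp⟩

theorem SemiDec.comp {P : β → Prop} (hP : SemiDec P) {f : α → β} (hf : Primrec f) :
    SemiDec fun a => P (f a) := by
  obtain ⟨R, hR, hPR⟩ := hP
  exact ⟨fun a n => R (f a) n, hR.comp (hf.comp Primrec.fst) Primrec.snd, fun a => hPR (f a)⟩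

theorem SemiDec.and {P Q : α → Prop} (hP : SemiDec P) (hQ : SemiDec Q) :
    SemiDec fun a => P a ∧ Q a := by
  obtain ⟨R, hR, hPR⟩ := hP
  obtain ⟨S, hS, hQS⟩ := hQ
  refine ⟨fun a n => R a n.unpair.1 ∧ S a n.unpair.2, ?_, fun a => ?_⟩
  · exact PrimrecPred.and
      (hR.comp Primrec.fst (Primrec.fst.comp (Primrec.unpair.comp Primrec.snd)))
      (hS.comp Primrec.fst (Primrec.snd.comp (Primrec.unpair.comp Primrec.snd)))
  · simp only [hPR, hQS]
    constructor
    · rintro ⟨⟨m, hm⟩, n, hn⟩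
      exact ⟨Nat.pair m n, by simpa using ⟨hm, hn⟩⟩
    · rintro ⟨n, h1, h2⟩
      exact ⟨⟨_, h1⟩, _, h2⟩

theorem SemiDec.exists {P : α → β → Prop} (hP : SemiDec fun p : α × β => P p.1 p.2) :
    SemiDec fun a => ∃ b, P a b := by
  obtain ⟨R, hR, hPR⟩ := hP
  refine ⟨fun a n => ∃ b ∈ (Encodable.decode (α := β) n.unpair.1).toList,
    R (a, b) n.unpair.2, ?_, fun a => ?_⟩
  · have h1 : PrimrecRel fun (b : β) (q : α × ℕ) => R (q.1, b) q.2.unpair.2 :=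
      hR.comp (Primrec.pair (Primrec.fst.comp Primrec.snd) Primrec.fst)
        (Primrec.snd.comp (Primrec.unpair.comp (Primrec.snd.comp Primrec.snd)))
    exact h1.exists_mem_list.comp
      (Primrec.optionToList.comp
        (Primrec.decode.comp (Primrec.fst.comp (Primrec.unpair.comp Primrec.snd)))) Primrec.id
  · constructor
    · rintro ⟨b, hb⟩
      obtain ⟨n, hn⟩ := (hPR (a, b)).1 hb
      exact ⟨Nat.pair (Encodable.encode b) n, b, by simp, by simpa using hn⟩
    · rintro ⟨n, b, -, hb⟩
      exact ⟨b, (hPR (a, b)).2 ⟨_, hb⟩⟩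

theorem SemiDec.forall_mem {P : α → β → Prop} (hP : SemiDec fun p : α × β => P p.1 p.2)
    {f : α → List β} (hf : Primrec f) : SemiDec fun a => ∀ b ∈ f a, P a b := by
  obtain ⟨R, hR, hPR⟩ := hP
  refine ⟨fun a m => ∀ b ∈ f a, ∃ n < m, R (a, b) n, ?_, fun a => ?_⟩
  · have h1 : PrimrecRel fun (n : ℕ) (q : α × β) => R q n := hR.comp Primrec.snd Primrec.fst
    have h2 : PrimrecPred fun r : β × (α × ℕ) => ∃ n < r.2.2, R (r.2.1, r.1) n :=
      (h1.exists_mem_list.comp (Primrec.list_range.comp (Primrec.snd.comp Primrec.snd))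
        (Primrec.pair (Primrec.fst.comp Primrec.snd) Primrec.fst)).of_eq fun r => by simp
    have h3 : PrimrecRel fun (b : β) (q : α × ℕ) => ∃ n < q.2, R (q.1, b) n := h2
    exact h3.forall_mem_list.comp (hf.comp Primrec.fst) Primrec.id
  · constructor
    · intro h
      choose! n hn using fun b hb => (hPR (a, b)).1 (h b hb)
      -- The sum of the finitely many witnesses bounds each of them.
      refine ⟨((f a).map n).sum + 1, fun b hb => ⟨n b, ?_, hn b hb⟩⟩
      exact Nat.lt_succ_of_le (List.le_sum_of_mem (List.mem_map_of_mem hb))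
    · rintro ⟨m, hm⟩ b hb
      obtain ⟨n, -, hn⟩ := hm b hb
      exact (hPR (a, b)).2 ⟨n, hn⟩

theorem SemiDec.forall_lt {P : α → ℕ → Prop} (hP : SemiDec fun p : α × ℕ => P p.1 p.2)
    {f : α → ℕ} (hf : Primrec f) : SemiDec fun a => ∀ n < f a, P a n :=
  (hP.forall_mem (Primrec.list_range.comp hf)).of_eq fun a => by simp

/-- Step-bounded evaluation is primitive recursive, and a value is output exactly when some bound
suffices to reach it. -/
theorem _root_.Partrec.semiDec_mem {φ : α →. β} (hφ : Partrec φ) :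
    SemiDec fun p : α × β => p.2 ∈ φ p.1 := by
  obtain ⟨c, hc⟩ := Nat.Partrec.Code.exists_code.1 hφ
  refine ⟨fun p n => Nat.Partrec.Code.evaln n c (Encodable.encode p.1)
    = some (Encodable.encode p.2), ?_, fun p => ?_⟩
  · exact Primrec.eq.comp
      (Nat.Partrec.Code.primrec_evaln.comp
        (Primrec.pair (Primrec.pair Primrec.snd (Primrec.const c))
          (Primrec.encode.comp (Primrec.fst.comp Primrec.fst))))
      (Primrec.option_some.comp (Primrec.encode.comp (Primrec.snd.comp Primrec.fst)))
  · have h := @Nat.Partrec.Code.evaln_complete c (Encodable.encode p.1) (Encodable.encode p.2)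
    rw [hc] at h
    simp only [Option.mem_def] at h
    rw [← h]
    simp

/-- A computable `f` cannot be substituted into a primitive recursive relation; its semidecidable
graph can be used instead, with the value quantified existentially. -/
theorem SemiDec.comp_computable {P : β → Prop} (hP : SemiDec P) {f : α → β} (hf : Computable f) :
    SemiDec fun a => P (f a) := by
  have h : SemiDec fun p : α × β => p.2 ∈ (f : α →. β) p.1 ∧ P p.2 :=
    (Partrec.semiDec_mem hf).and (hP.comp Primrec.snd)
  exact (SemiDec.exists (P := fun a b => b ∈ (f : α →. β) a ∧ P b) h).of_eq fun a => by simp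

/-- Effective choice: a witness for a semidecidable relation can be found by unbounded search. -/
theorem SemiDec.exists_partrec_choice {P : α → β → Prop} (hP : SemiDec fun p : α × β => P p.1 p.2) :
    ∃ f : α →. β, Partrec f ∧ (∀ a, ∀ b ∈ f a, P a b) ∧ ∀ a, (∃ b, P a b) → (f a).Dom := by
  classical
  obtain ⟨R, hR, hPR⟩ := hP
  -- Dovetailing: `n` codes a candidate together with a witness for it.
  let g : α → ℕ → Option β := fun a n =>
    (Encodable.decode (α := β) n.unpair.1).bind fun b =>
      if R (a, b) n.unpair.2 then some b else none
  have hg : Primrec₂ g := by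
    refine Primrec.option_bind
      (Primrec.decode.comp (Primrec.fst.comp (Primrec.unpair.comp Primrec.snd))) ?_
    refine Primrec.ite ?_ (Primrec.option_some.comp Primrec.snd) (Primrec.const none)
    exact hR.comp (Primrec.pair (Primrec.fst.comp Primrec.fst) Primrec.snd)
      (Primrec.snd.comp (Primrec.unpair.comp (Primrec.snd.comp Primrec.fst)))
  refine ⟨fun a => Nat.rfindOpt (g a), Partrec.rfindOpt hg.to_comp, fun a b hb => ?_, ?_⟩
  · obtain ⟨n, hn⟩ := Nat.rfindOpt_spec hb
    simp only [g, Option.mem_def, Option.bind_eq_some_iff] at hn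
    obtain ⟨b', -, hb'⟩ := hn
    split_ifs at hb' with h
    · cases hb'
      exact (hPR (a, b)).2 ⟨_, h⟩
  · rintro a ⟨b, hb⟩
    obtain ⟨n, hn⟩ := (hPR (a, b)).1 hb
    refine Nat.rfindOpt_dom.2 ⟨Nat.pair (Encodable.encode b) n, b, ?_⟩
    simp [g, hn]

/-- Effective dependent choice along a semidecidable relation. -/
theorem SemiDec.exists_computable_seq {Q : ℕ × α → α → Prop}
    (hQ : SemiDec fun p : (ℕ × α) × α => Q p.1 p.2) {P : α → Prop}
    (hstep : ∀ n a, P a → ∃ b, Q (n, a) b) (hP : ∀ n a b, Q (n, a) b → P b) {a₀ : α} (h₀ : P a₀) :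
    ∃ h : ℕ → α, Computable h ∧ h 0 = a₀ ∧ ∀ n, Q (n, h n) (h (n + 1)) := by
  obtain ⟨f, hf, hfQ, hfdom⟩ := hQ.exists_partrec_choice
  let F : ℕ →. α := fun n =>
    n.rec (Part.some a₀) fun y ih => ih.bind fun i => f (y, i)
  have hF : Partrec F := Partrec.nat_rec (f := fun n : ℕ => n) (g := fun _ => Part.some a₀)
    (h := fun _ p => f p) Computable.id (Computable.const a₀) (hf.comp Computable.snd)
  -- `F` is a priori partial; the invariant `P` makes every search along the orbit halt.
  have key : ∀ n, ∃ a, a ∈ F n ∧ P a := by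
    intro n
    induction n with
    | zero => exact ⟨a₀, Part.mem_some _, h₀⟩
    | succ n ih =>
      obtain ⟨a, ha, hPa⟩ := ih
      have hd := hfdom (n, a) (hstep n a hPa)
      exact ⟨_, Part.mem_bind ha (Part.get_mem hd), hP _ _ _ (hfQ _ _ (Part.get_mem hd))⟩
  choose h hmem hPh using key
  refine ⟨h, hF.of_eq_tot hmem, Part.mem_some_iff.1 (hmem 0), fun n => ?_⟩
  obtain ⟨a, ha, hb⟩ := Part.mem_bind_iff.1 (hmem (n + 1))
  rw [Part.mem_unique (hmem n) ha]
  exact hfQ _ _ hb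

end SemiDec

/-! ### Arithmetic on numbers of rationals -/

/-- A number of the sum of two numbered rationals. -/
def ratAdd (x y : ℕ) : ℕ :=
  Nat.pair
    (Nat.pair (x.unpair.1.unpair.1 * (y.unpair.2 + 1) + y.unpair.1.unpair.1 * (x.unpair.2 + 1))
      (x.unpair.1.unpair.2 * (y.unpair.2 + 1) + y.unpair.1.unpair.2 * (x.unpair.2 + 1)))
    ((x.unpair.2 + 1) * (y.unpair.2 + 1) - 1)

/-- A number of a rational given by its number as a positive rational. -/
def ratOfPosRat (n : ℕ) : ℕ := Nat.pair (Nat.pair (n.unpair.1 + 1) 0) n.unpair.2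

/-- A number of `2⁻ⁿ`. -/
def ratHalfPow (n : ℕ) : ℕ := Nat.pair (Nat.pair 1 0) (2 ^ n - 1)

/-- A number of `2⁻ⁿ` as a positive rational. -/
def posRatHalfPow (n : ℕ) : ℕ := Nat.pair 0 (2 ^ n - 1)

theorem rat_ratAdd (x y : ℕ) : rat (ratAdd x y) = rat x + rat y := by
  have h : (((x.unpair.2 + 1) * (y.unpair.2 + 1) - 1 : ℕ) : ℚ) + 1
      = ((x.unpair.2 : ℚ) + 1) * ((y.unpair.2 : ℚ) + 1) := by
    have : 0 < (x.unpair.2 + 1) * (y.unpair.2 + 1) := by positivity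
    exact_mod_cast Nat.sub_add_cancel this
  simp only [rat, ratAdd, Nat.unpair_pair, h]
  push_cast
  field_simp
  ring

theorem rat_ratOfPosRat (n : ℕ) : rat (ratOfPosRat n) = posRat n := by
  simp [rat, ratOfPosRat, posRat]

theorem two_pow_sub_one_add_one (n : ℕ) : ((2 ^ n - 1 : ℕ) : ℚ) + 1 = 2 ^ n := by
  have : 0 < 2 ^ n := by positivity
  exact_mod_cast Nat.sub_add_cancel this

theorem rat_ratHalfPow (n : ℕ) : rat (ratHalfPow n) = (1 / 2) ^ n := by
  simp only [rat, ratHalfPow, Nat.unpair_pair, two_pow_sub_one_add_one]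
  simp

theorem posRat_posRatHalfPow (n : ℕ) : posRat (posRatHalfPow n) = (1 / 2) ^ n := by
  simp only [posRat, posRatHalfPow, Nat.unpair_pair, two_pow_sub_one_add_one]
  simp

theorem rat_lt_rat_iff (x y : ℕ) : rat x < rat y ↔
    x.unpair.1.unpair.1 * (y.unpair.2 + 1) + y.unpair.1.unpair.2 * (x.unpair.2 + 1)
      < y.unpair.1.unpair.1 * (x.unpair.2 + 1) + x.unpair.1.unpair.2 * (y.unpair.2 + 1) := by
  rw [rat, rat, div_lt_div_iff₀ (by positivity) (by positivity), ← Nat.cast_lt (α := ℚ)]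
  push_cast
  constructor <;> intro h <;> linarith

theorem primrec_fst_unpair : Primrec fun n : ℕ => n.unpair.1 := Primrec.fst.comp Primrec.unpair

theorem primrec_snd_unpair : Primrec fun n : ℕ => n.unpair.2 := Primrec.snd.comp Primrec.unpair

theorem primrec_two_pow_sub_one : Primrec fun n : ℕ => 2 ^ n - 1 :=
  Primrec.nat_sub.comp
    ((Primrec₂.unpaired'.1 Nat.Primrec.pow).comp (Primrec.const 2) Primrec.id) (Primrec.const 1)

theorem primrec_ratHalfPow : Primrec ratHalfPow :=
  Primrec₂.natPair.comp (Primrec.const _) primrec_two_pow_sub_one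

theorem primrec_posRatHalfPow : Primrec posRatHalfPow :=
  Primrec₂.natPair.comp (Primrec.const _) primrec_two_pow_sub_one

theorem primrec_ratOfPosRat : Primrec ratOfPosRat :=
  Primrec₂.natPair.comp
    (Primrec₂.natPair.comp (Primrec.succ.comp primrec_fst_unpair) (Primrec.const 0))
    primrec_snd_unpair

section

variable {α : Type*} [Primcodable α]

theorem primrec_cross {f g h k : α → ℕ} (hf : Primrec f) (hg : Primrec g) (hh : Primrec h)
    (hk : Primrec k) : Primrec fun a => f a * (g a + 1) + h a * (k a + 1) :=
  Primrec.nat_add.comp (Primrec.nat_mul.comp hf (Primrec.succ.comp hg))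
    (Primrec.nat_mul.comp hh (Primrec.succ.comp hk))

theorem primrec_ratAdd : Primrec₂ ratAdd := by
  have a := (primrec_fst_unpair.comp primrec_fst_unpair).comp (Primrec.fst (α := ℕ) (β := ℕ))
  have b := (primrec_snd_unpair.comp primrec_fst_unpair).comp (Primrec.fst (α := ℕ) (β := ℕ))
  have c := primrec_snd_unpair.comp (Primrec.fst (α := ℕ) (β := ℕ))
  have a' := (primrec_fst_unpair.comp primrec_fst_unpair).comp (Primrec.snd (α := ℕ) (β := ℕ))
  have b' := (primrec_snd_unpair.comp primrec_fst_unpair).comp (Primrec.snd (α := ℕ) (β := ℕ))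
  have c' := primrec_snd_unpair.comp (Primrec.snd (α := ℕ) (β := ℕ))
  exact Primrec₂.natPair.comp
    (Primrec₂.natPair.comp (primrec_cross a c' a' c) (primrec_cross b c' b' c))
    (Primrec.nat_sub.comp
      (Primrec.nat_mul.comp (Primrec.succ.comp c) (Primrec.succ.comp c')) (Primrec.const 1))

theorem primrecRel_rat_lt : PrimrecRel fun x y : ℕ => rat x < rat y := by
  have a := (primrec_fst_unpair.comp primrec_fst_unpair).comp (Primrec.fst (α := ℕ) (β := ℕ))
  have b := (primrec_snd_unpair.comp primrec_fst_unpair).comp (Primrec.fst (α := ℕ) (β := ℕ))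
  have c := primrec_snd_unpair.comp (Primrec.fst (α := ℕ) (β := ℕ))
  have a' := (primrec_fst_unpair.comp primrec_fst_unpair).comp (Primrec.snd (α := ℕ) (β := ℕ))
  have b' := (primrec_snd_unpair.comp primrec_fst_unpair).comp (Primrec.snd (α := ℕ) (β := ℕ))
  have c' := primrec_snd_unpair.comp (Primrec.snd (α := ℕ) (β := ℕ))
  exact (Primrec.nat_lt.comp (primrec_cross a c' b' c) (primrec_cross a' c b c')).of_eq
    fun p => (rat_lt_rat_iff p.1 p.2).symm

/-- A number of the total weight that a named ideal measure gives to the points listed in `S`. -/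
def weightOn (S : List ℕ) (l : List (ℕ × ℕ)) : ℕ :=
  l.foldr (fun p w => if p.1 ∈ S then ratAdd p.2 w else w) 0

theorem rat_zero : rat 0 = 0 := by simp [rat]

theorem weightOn_nil (S : List ℕ) : weightOn S [] = 0 := rfl

theorem weightOn_cons (S : List ℕ) (p : ℕ × ℕ) (l : List (ℕ × ℕ)) :
    weightOn S (p :: l) = if p.1 ∈ S then ratAdd p.2 (weightOn S l) else weightOn S l := rfl

theorem primrec_weightOn : Primrec₂ weightOn := by
  refine Primrec.list_foldr (h := fun (a : List ℕ × List (ℕ × ℕ)) q =>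
    if q.1.1 ∈ a.1 then ratAdd q.1.2 q.2 else q.2) Primrec.snd (Primrec.const 0) ?_
  refine Primrec.ite ?_ ?_ (Primrec.snd.comp Primrec.snd)
  · have h : PrimrecRel fun (L : List ℕ) (x : ℕ) => ∃ y ∈ L, y = x :=
      PrimrecRel.exists_mem_list Primrec.eq
    exact (h.comp (Primrec.fst.comp Primrec.fst)
      (Primrec.fst.comp (Primrec.fst.comp Primrec.snd))).of_eq fun p => by simp
  · exact primrec_ratAdd.comp (Primrec.snd.comp (Primrec.fst.comp Primrec.snd))
      (Primrec.snd.comp Primrec.snd)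

theorem UniformlyComputableReal.semiDec_lt {x : α → ℝ} (hx : UniformlyComputableReal x) :
    SemiDec fun p : α × ℕ => x p.1 < rat p.2 := by
  obtain ⟨A, hA, hAx⟩ := hx
  have h1 : SemiDec fun q : ℕ × ℕ × ℕ => rat (ratAdd q.1 (ratHalfPow q.2.1)) < rat q.2.2 :=
    (primrecRel_rat_lt.comp
      (primrec_ratAdd.comp Primrec.fst (primrec_ratHalfPow.comp (Primrec.fst.comp Primrec.snd)))
      (Primrec.snd.comp Primrec.snd)).semiDec
  have hf : Computable fun q : (α × ℕ) × ℕ => (A q.1.1 q.2, q.2, q.1.2) :=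
    (hA.comp (Computable.fst.comp Computable.fst) Computable.snd).pair
      (Computable.snd.pair (Computable.snd.comp Computable.fst))
  have h2 : SemiDec fun q : (α × ℕ) × ℕ =>
      rat (ratAdd (A q.1.1 q.2) (ratHalfPow q.2)) < rat q.1.2 := by
    have h := h1.comp_computable hf
    exact h
  refine (SemiDec.exists (P := fun (p : α × ℕ) n =>
    rat (ratAdd (A p.1 n) (ratHalfPow n)) < rat p.2) h2).of_eq fun p => ?_
  simp only [rat_ratAdd, rat_ratHalfPow]
  constructor
  · rintro ⟨n, hn⟩
    have h2 := (Rat.cast_lt (K := ℝ)).2 hn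
    push_cast at h2
    have h3 := abs_le.1 (hAx p.1 n)
    linarith
  · intro h
    -- The error `2⁻ⁿ` enters twice: in the approximation and in the safety margin of the test.
    obtain ⟨n, hn⟩ := exists_pow_lt_of_lt_one (half_pos (sub_pos.2 h))
      (by norm_num : (1 / 2 : ℝ) < 1)
    refine ⟨n, ?_⟩
    have h3 := abs_le.1 (hAx p.1 n)
    rw [← Rat.cast_lt (K := ℝ)]
    push_cast
    linarith

end

/-! ### Formal inclusion of ideal balls -/

section Metric

variable {X : Type*} [MetricSpace X] {s : ℕ → X}

/-- Formal inclusion in an ideal ball of the ball of numbered radius around an ideal point. -/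
theorem IsComputableMetricSpace.semiDec_dist_add_lt (hs : IsComputableMetricSpace s) :
    SemiDec fun p : ℕ × ℕ × ℕ =>
      dist (s p.1) (s p.2.2.unpair.1) + rat p.2.1 < (posRat p.2.2.unpair.2 : ℝ) := by
  have h1 : SemiDec fun q : (ℕ × ℕ × ℕ) × ℕ =>
      dist (s q.1.1) (s q.1.2.2.unpair.1) < rat q.2 :=
    hs.dist_computable.semiDec_lt.comp (f := fun q : (ℕ × ℕ × ℕ) × ℕ =>
        ((q.1.1, q.1.2.2.unpair.1), q.2))
      (((Primrec.fst.comp Primrec.fst).pair (primrec_fst_unpair.comp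
        (Primrec.snd.comp (Primrec.snd.comp Primrec.fst)))).pair Primrec.snd)
  have h2 : SemiDec fun q : (ℕ × ℕ × ℕ) × ℕ =>
      rat (ratAdd q.2 q.1.2.1) < rat (ratOfPosRat q.1.2.2.unpair.2) :=
    (primrecRel_rat_lt.comp
      (primrec_ratAdd.comp Primrec.snd (Primrec.fst.comp (Primrec.snd.comp Primrec.fst)))
      (primrec_ratOfPosRat.comp (primrec_snd_unpair.comp
        (Primrec.snd.comp (Primrec.snd.comp Primrec.fst))))).semiDec
  refine (SemiDec.exists (P := fun (p : ℕ × ℕ × ℕ) t => dist (s p.1) (s p.2.2.unpair.1) < rat t ∧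
    rat (ratAdd t p.2.1) < rat (ratOfPosRat p.2.2.unpair.2)) (h1.and h2)).of_eq fun p => ?_
  simp only [rat_ratAdd, rat_ratOfPosRat]
  constructor
  · rintro ⟨t, ht1, ht2⟩
    have ht3 : (rat t : ℝ) + rat p.2.1 < posRat p.2.2.unpair.2 := by exact_mod_cast ht2
    linarith
  · intro h
    obtain ⟨q, hq1, hq2⟩ := exists_rat_btwn (lt_sub_iff_add_lt.2 h)
    obtain ⟨t, rfl⟩ := rat_surjective q
    refine ⟨t, hq1, ?_⟩
    have : (rat t : ℝ) + rat p.2.1 < posRat p.2.2.unpair.2 := by linarith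
    exact_mod_cast this

end Metric

/-! ### Measures of finite intersections of constructive open sets -/

section Inner

open Filter Topology

variable {X : Type*} [MetricSpace X] {s : ℕ → X} {ι : Type*}

/-- The points lying at depth more than `δ` in a listed ideal ball of each of the lists `D j`. -/
def innerInter (s : ℕ → X) (D : ι → Set ℕ) (δ : ℝ) : Set X :=
  {x | ∀ j, ∃ b ∈ D j, dist x (s b.unpair.1) + δ < posRat b.unpair.2}

theorem isOpen_innerInter [Finite ι] (D : ι → Set ℕ) (δ : ℝ) : IsOpen (innerInter s D δ) := by
  have : innerInter s D δ
      = ⋂ j, ⋃ b ∈ D j, {x | dist x (s b.unpair.1) + δ < posRat b.unpair.2} := by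
    ext x
    simp [innerInter]
  rw [this]
  exact isOpen_iInter_of_finite fun j => isOpen_biUnion fun b _ =>
    isOpen_lt (by fun_prop) continuous_const

theorem innerInter_anti (D : ι → Set ℕ) : Antitone (innerInter s D) := by
  intro δ ε h x hx j
  obtain ⟨b, hb, hx⟩ := hx j
  exact ⟨b, hb, by linarith⟩

/-- Moving a point by less than `ε` costs at most `ε` of depth. This absorbs the thickening in the
Prokhorov inequalities. -/
theorem thickening_innerInter_subset (D : ι → Set ℕ) {δ ε η : ℝ} (h : η + ε ≤ δ) :
    Metric.thickening ε (innerInter s D δ) ⊆ innerInter s D η := by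
  intro x hx j
  obtain ⟨y, hy, hxy⟩ := Metric.mem_thickening_iff.1 hx
  obtain ⟨b, hb, hy⟩ := hy j
  exact ⟨b, hb, by linarith [dist_triangle x y (s b.unpair.1)]⟩

theorem tendsto_two_mul_half_pow : Tendsto (fun m : ℕ => 2 * (1 / 2 : ℝ) ^ m) atTop (𝓝 0) := by
  simpa using (tendsto_pow_atTop_nhds_zero_of_lt_one (by norm_num : (0 : ℝ) ≤ 1 / 2)
    (by norm_num)).const_mul 2

/-- Each strict inequality leaves some room, and finiteness of `ι` gives one `m` for all
constraints. The factor `2` leaves depth `2⁻ᵐ` after a thickening by `2⁻ᵐ`. -/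
theorem iUnion_innerInter [Finite ι] (D : ι → Set ℕ) :
    ⋃ m : ℕ, innerInter s D (2 * (1 / 2) ^ m) = innerInter s D 0 := by
  apply Subset.antisymm
  · exact iUnion_subset fun m => innerInter_anti D (by positivity)
  · intro x hx
    have h : ∀ᶠ m : ℕ in atTop, ∀ j, ∃ b ∈ D j,
        dist x (s b.unpair.1) + 2 * (1 / 2) ^ m < posRat b.unpair.2 := by
      refine eventually_all.2 fun j => ?_
      obtain ⟨b, hb, hx⟩ := hx j
      have h1 := (tendsto_two_mul_half_pow.const_add (dist x (s b.unpair.1))).eventually_lt_const hx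
      exact h1.mono fun m hm => ⟨b, hb, hm⟩
    obtain ⟨m, hm⟩ := h.exists
    exact mem_iUnion.2 ⟨m, hm⟩

/-! ### Ideal measures and Prokhorov estimates -/

theorem ofReal_half_pow (n : ℕ) : ENNReal.ofReal ((1 / 2 : ℝ) ^ n) = (2⁻¹ : ℝ≥0∞) ^ n := by
  rw [ENNReal.ofReal_pow (by norm_num), one_div, ENNReal.ofReal_inv_of_pos (by norm_num)]
  simp

theorem idealMeasure_cons_apply {X : Type*} [MeasurableSpace X] {s : ℕ → X} (p : ℕ × ℕ) (l : List (ℕ × ℕ)) {A : Set X}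
    (hA : MeasurableSet A) : idealMeasure s (p :: l) A =
      ENNReal.ofReal (rat p.2) * A.indicator 1 (s p.1) + idealMeasure s l A := by
  simp [idealMeasure, hA]

theorem rat_weightOn_nonneg (S : List ℕ) {l : List (ℕ × ℕ)} (hl : ∀ p ∈ l, 0 ≤ rat p.2) :
    0 ≤ rat (weightOn S l) := by
  induction l with
  | nil => simp [weightOn_nil, rat_zero]
  | cons p l ih =>
    have h1 := ih fun q hq => hl q (List.mem_cons_of_mem _ hq)
    have h2 := hl p List.mem_cons_self
    rw [weightOn_cons]
    split_ifs
    · rw [rat_ratAdd]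
      positivity
    · exact h1

theorem weightOn_le_idealMeasure {X : Type*} [MeasurableSpace X] {s : ℕ → X} {S : List ℕ} {l : List (ℕ × ℕ)} (hl : ∀ p ∈ l, 0 ≤ rat p.2)
    {A : Set X} (hA : MeasurableSet A) (hS : ∀ i ∈ S, s i ∈ A) :
    ENNReal.ofReal (rat (weightOn S l)) ≤ idealMeasure s l A := by
  induction l with
  | nil => simp [weightOn_nil, rat_zero]
  | cons p l ih =>
    have hl' : ∀ q ∈ l, 0 ≤ rat q.2 := fun q hq => hl q (List.mem_cons_of_mem _ hq)
    have h2 := hl p List.mem_cons_self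
    rw [weightOn_cons, idealMeasure_cons_apply p l hA]
    split_ifs with h
    · rw [rat_ratAdd, Rat.cast_add, ENNReal.ofReal_add (by exact_mod_cast h2)
        (by exact_mod_cast rat_weightOn_nonneg S hl'), indicator_of_mem (hS _ h)]
      exact add_le_add (by simp) (ih hl')
    · exact (ih hl').trans le_add_self

theorem idealMeasure_le_weightOn {X : Type*} [MeasurableSpace X] {s : ℕ → X} {S : List ℕ} {l : List (ℕ × ℕ)} (hl : ∀ p ∈ l, 0 ≤ rat p.2)
    {A : Set X} (hA : MeasurableSet A) (hS : ∀ p ∈ l, s p.1 ∈ A → p.1 ∈ S) :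
    idealMeasure s l A ≤ ENNReal.ofReal (rat (weightOn S l)) := by
  induction l with
  | nil => simp [idealMeasure]
  | cons p l ih =>
    have hl' : ∀ q ∈ l, 0 ≤ rat q.2 := fun q hq => hl q (List.mem_cons_of_mem _ hq)
    have ih' := ih hl' fun q hq => hS q (List.mem_cons_of_mem _ hq)
    have h2 := hl p List.mem_cons_self
    rw [weightOn_cons, idealMeasure_cons_apply p l hA]
    split_ifs with h
    · rw [rat_ratAdd, Rat.cast_add, ENNReal.ofReal_add (by exact_mod_cast h2)
        (by exact_mod_cast rat_weightOn_nonneg S hl')]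
      refine add_le_add ?_ ih'
      by_cases hp : s p.1 ∈ A <;> simp [hp]
    · rw [indicator_of_notMem fun hp => h (hS p List.mem_cons_self hp)]
      simpa using ih'

variable [MeasurableSpace X] {μ : Measure X} {F : ℕ → List (ℕ × ℕ)}

/-- The index shift provides the strict bound that the Prokhorov inequalities require. -/
theorem levyProkhorovEDist_succ_lt (hF : ∀ n, IsIdealMeasureName (F n) ∧
    levyProkhorovEDist (idealMeasure s (F n)) μ ≤ (2⁻¹ : ℝ≥0∞) ^ n) (m : ℕ) :
    levyProkhorovEDist (idealMeasure s (F (m + 1))) μ < ENNReal.ofReal ((1 / 2 : ℝ) ^ m) := by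
  refine (hF (m + 1)).2.trans_lt ?_
  rw [← ofReal_half_pow]
  exact (ENNReal.ofReal_lt_ofReal_iff (by positivity)).2
    (pow_lt_pow_right_of_lt_one₀ (by norm_num) (by norm_num) (Nat.lt_succ_self m))

variable [BorelSpace X]

/-- Soundness of the lower bounds: the weight on `S` is at most the ideal measure of the set at
depth `2⁻ᵐ`, hence at most `2⁻ᵐ` plus the measure of its thickening, which stays in the set at depth
`0`. The list `S` need only consist of points already recognised as lying inside, so membership
never has to be refuted. -/
theorem lt_measure_of_lt_weightOn [Finite ι] (hF : ∀ n, IsIdealMeasureName (F n) ∧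
    levyProkhorovEDist (idealMeasure s (F n)) μ ≤ (2⁻¹ : ℝ≥0∞) ^ n)
    {D : ι → Set ℕ} {t : ℝ} (ht : 0 ≤ t) {m : ℕ} {S : List ℕ}
    (hS : ∀ i ∈ S, s i ∈ innerInter s D ((1 / 2) ^ m))
    (hlt : t + (1 / 2) ^ m < rat (weightOn S (F (m + 1)))) :
    ENNReal.ofReal t < μ (innerInter s D 0) := by
  have hm : (0 : ℝ) ≤ (1 / 2) ^ m := by positivity
  have hA := (isOpen_innerInter (s := s) D ((1 / 2) ^ m)).measurableSet
  have h1 := left_measure_le_of_levyProkhorovEDist_lt (levyProkhorovEDist_succ_lt hF m) hA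
  rw [ENNReal.toReal_ofReal hm] at h1
  have h2 := measure_mono (μ := μ) (thickening_innerInter_subset (s := s) D
    (δ := (1 / 2) ^ m) (ε := (1 / 2) ^ m) (η := 0) (by simp))
  have h3 := (weightOn_le_idealMeasure (hF (m + 1)).1.1 hA hS).trans
    (h1.trans (add_le_add_left h2 _))
  have h4 := ((ENNReal.ofReal_lt_ofReal_iff_of_nonneg (by positivity)).2 hlt).trans_le h3
  rw [ENNReal.ofReal_add ht hm] at h4
  exact lt_of_add_lt_add_right h4

/-- Completeness of the lower bounds: by continuity from below, depth `2 * 2⁻ᵐ` loses little measure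
for large `m`. One `2⁻ᵐ` of depth is spent on the thickening, and one `2⁻ᵐ` of measure on the
Prokhorov error. -/
theorem exists_lt_weightOn_of_lt_measure [Finite ι] (hF : ∀ n, IsIdealMeasureName (F n) ∧
    levyProkhorovEDist (idealMeasure s (F n)) μ ≤ (2⁻¹ : ℝ≥0∞) ^ n)
    {D : ι → Set ℕ} {t : ℝ} (ht : 0 ≤ t) (h : ENNReal.ofReal t < μ (innerInter s D 0)) :
    ∃ (m : ℕ) (S : List ℕ), (∀ i ∈ S, s i ∈ innerInter s D ((1 / 2) ^ m)) ∧
      t + (1 / 2) ^ m < rat (weightOn S (F (m + 1))) := by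
  classical
  have hmono : Monotone fun m : ℕ => innerInter s D (2 * (1 / 2) ^ m) := fun m n hmn =>
    innerInter_anti D (mul_le_mul_of_nonneg_left
      (pow_le_pow_of_le_one (by norm_num) (by norm_num) hmn) (by norm_num))
  have h1 := tendsto_measure_iUnion_atTop (μ := μ) hmono
  rw [iUnion_innerInter] at h1
  have h2 : Tendsto (fun m : ℕ => ENNReal.ofReal (t + 2 * (1 / 2 : ℝ) ^ m)) atTop
      (𝓝 (ENNReal.ofReal t)) := by
    simpa using ENNReal.tendsto_ofReal (tendsto_two_mul_half_pow.const_add t)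
  obtain ⟨m, hm⟩ := (h2.eventually_lt h1 h).exists
  have hm0 : (0 : ℝ) ≤ (1 / 2) ^ m := by positivity
  have h3 := right_measure_le_of_levyProkhorovEDist_lt (levyProkhorovEDist_succ_lt hF m)
    (isOpen_innerInter (s := s) D (2 * (1 / 2) ^ m)).measurableSet
  rw [ENNReal.toReal_ofReal hm0] at h3
  have h4 := measure_mono (μ := idealMeasure s (F (m + 1))) (thickening_innerInter_subset (s := s) D
    (δ := 2 * (1 / 2) ^ m) (ε := (1 / 2) ^ m) (η := (1 / 2) ^ m) (by linarith))
  let S : List ℕ := ((F (m + 1)).map Prod.fst).filter fun i => s i ∈ innerInter s D ((1 / 2) ^ m)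
  have h5 := idealMeasure_le_weightOn (S := S) (hF (m + 1)).1.1
    (isOpen_innerInter (s := s) D ((1 / 2) ^ m)).measurableSet fun p hp hpA => by
      simp only [S, List.mem_filter, List.mem_map]
      exact ⟨⟨p, hp, rfl⟩, by simpa using hpA⟩
  refine ⟨m, S, fun i hi => by simpa using (List.mem_filter.1 hi).2, ?_⟩
  have h6 := hm.trans_le (h3.trans (add_le_add_left (h4.trans h5) _))
  have h7 : t + 2 * (1 / 2 : ℝ) ^ m = (t + (1 / 2) ^ m) + (1 / 2) ^ m := by ring
  rw [h7, ENNReal.ofReal_add (by positivity) hm0] at h6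
  exact (ENNReal.ofReal_lt_ofReal_iff_of_nonneg (by positivity)).1 (lt_of_add_lt_add_right h6)

end Inner

/-! ### Computable points in effectively large intersections of open sets -/

section Core

open Filter Topology

variable {X : Type*} {s : ℕ → X}

/-- The conditions "lies in the ideal ball `B` and in the first `N` constructive open sets". -/
def ballConstraints (E : ℕ → ℕ → Prop) (B N : ℕ) : Option (Fin N) → Set ℕ
  | none => {B}
  | some j => {b | E j b}

variable [MetricSpace X]

theorem mem_innerInter_ballConstraints {E : ℕ → ℕ → Prop} {B N : ℕ} {δ : ℝ} {x : X} :
    x ∈ innerInter s (ballConstraints E B N) δ ↔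
      dist x (s B.unpair.1) + δ < posRat B.unpair.2 ∧
        ∀ j < N, ∃ b, E j b ∧ dist x (s b.unpair.1) + δ < posRat b.unpair.2 := by
  simp [innerInter, Option.forall, ballConstraints, Fin.forall_iff]

theorem innerInter_ballConstraints_zero (E : ℕ → ℕ → Prop) (B N : ℕ) :
    innerInter s (ballConstraints E B N) 0
      = idealBall s B ∩ ⋂ j < N, ⋃ b ∈ {b | E j b}, idealBall s b := by
  ext x
  simp [mem_innerInter_ballConstraints, idealBall]

/-- A finite certificate that `B` has positive measure in the intersection of all the open sets:
in the first `N` of them, `B` retains more measure than the remaining ones can remove. -/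
def PositivityCertificate (s : ℕ → X) (F : ℕ → List (ℕ × ℕ)) (E T : ℕ → ℕ → Prop) (B : ℕ)
    (c : ℕ × ℕ × ℕ × List ℕ) : Prop :=
  T c.1 c.2.1 ∧
    (∀ i ∈ c.2.2.2, s i ∈ innerInter s (ballConstraints E B c.2.1) ((1 / 2) ^ c.2.2.1)) ∧
    (1 / 2 : ℝ) ^ c.1 + (1 / 2) ^ c.2.2.1 < rat (weightOn c.2.2.2 (F (c.2.2.1 + 1)))

variable {F : ℕ → List (ℕ × ℕ)} {E T : ℕ → ℕ → Prop}

theorem semiDec_mem_innerInter (hs : IsComputableMetricSpace s)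
    (hE : SemiDec fun p : ℕ × ℕ => E p.1 p.2) :
    SemiDec fun p : ℕ × ℕ × ℕ × ℕ =>
      s p.1 ∈ innerInter s (ballConstraints E p.2.1 p.2.2.1) ((1 / 2) ^ p.2.2.2) := by
  have h := hs.semiDec_dist_add_lt
  have h1 : SemiDec fun p : ℕ × ℕ × ℕ × ℕ =>
      dist (s p.1) (s p.2.1.unpair.1) + rat (ratHalfPow p.2.2.2) < (posRat p.2.1.unpair.2 : ℝ) :=
    h.comp (f := fun p : ℕ × ℕ × ℕ × ℕ => (p.1, ratHalfPow p.2.2.2, p.2.1))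
      (Primrec.fst.pair ((primrec_ratHalfPow.comp
        (Primrec.snd.comp (Primrec.snd.comp Primrec.snd))).pair
          (Primrec.fst.comp Primrec.snd)))
  have h2 : SemiDec fun q : ((ℕ × ℕ × ℕ × ℕ) × ℕ) × ℕ => E q.1.2 q.2 :=
    hE.comp (f := fun q : ((ℕ × ℕ × ℕ × ℕ) × ℕ) × ℕ => (q.1.2, q.2))
      ((Primrec.snd.comp Primrec.fst).pair Primrec.snd)
  have h3 : SemiDec fun q : ((ℕ × ℕ × ℕ × ℕ) × ℕ) × ℕ =>
      dist (s q.1.1.1) (s q.2.unpair.1) + rat (ratHalfPow q.1.1.2.2.2)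
        < (posRat q.2.unpair.2 : ℝ) :=
    h.comp (f := fun q : ((ℕ × ℕ × ℕ × ℕ) × ℕ) × ℕ => (q.1.1.1, ratHalfPow q.1.1.2.2.2, q.2))
      ((Primrec.fst.comp (Primrec.fst.comp Primrec.fst)).pair ((primrec_ratHalfPow.comp
        (Primrec.snd.comp (Primrec.snd.comp (Primrec.snd.comp
          (Primrec.fst.comp Primrec.fst))))).pair Primrec.snd))
  have h4 := SemiDec.exists (P := fun (q : (ℕ × ℕ × ℕ × ℕ) × ℕ) b => E q.2 b ∧
    dist (s q.1.1) (s b.unpair.1) + rat (ratHalfPow q.1.2.2.2) < (posRat b.unpair.2 : ℝ))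
    (h2.and h3)
  have h5 := SemiDec.forall_lt (P := fun (p : ℕ × ℕ × ℕ × ℕ) j => ∃ b, E j b ∧
    dist (s p.1) (s b.unpair.1) + rat (ratHalfPow p.2.2.2) < (posRat b.unpair.2 : ℝ)) h4
    (f := fun p => p.2.2.1) (Primrec.fst.comp (Primrec.snd.comp Primrec.snd))
  refine (h1.and h5).of_eq fun p => ?_
  rw [mem_innerInter_ballConstraints]
  simp [rat_ratHalfPow]

theorem semiDec_lt_weightOn (hF : Computable F) : SemiDec fun c : ℕ × ℕ × ℕ × List ℕ =>
    (1 / 2 : ℝ) ^ c.1 + (1 / 2) ^ c.2.2.1 < rat (weightOn c.2.2.2 (F (c.2.2.1 + 1))) := by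
  have h1 : SemiDec fun q : (ℕ × ℕ × ℕ × List ℕ) × List (ℕ × ℕ) =>
      rat (ratAdd (ratHalfPow q.1.1) (ratHalfPow q.1.2.2.1)) < rat (weightOn q.1.2.2.2 q.2) :=
    (primrecRel_rat_lt.comp
      (primrec_ratAdd.comp (primrec_ratHalfPow.comp (Primrec.fst.comp Primrec.fst))
        (primrec_ratHalfPow.comp
          (Primrec.fst.comp (Primrec.snd.comp (Primrec.snd.comp Primrec.fst)))))
      (primrec_weightOn.comp
        (Primrec.snd.comp (Primrec.snd.comp (Primrec.snd.comp Primrec.fst)))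
        Primrec.snd)).semiDec
  have hf : Computable fun c : ℕ × ℕ × ℕ × List ℕ => (c, F (c.2.2.1 + 1)) :=
    Computable.id.pair (hF.comp (Computable.succ.comp
      (Computable.fst.comp (Computable.snd.comp Computable.snd))))
  refine (h1.comp_computable hf).of_eq fun c => ?_
  rw [← Rat.cast_lt (K := ℝ), rat_ratAdd, rat_ratHalfPow, rat_ratHalfPow]
  simp

/-- With `exists_certificate_iff`, this makes positivity of measure a condition that the search for
balls can test. -/
theorem semiDec_exists_certificate (hs : IsComputableMetricSpace s) (hF : Computable F)
    (hE : SemiDec fun p : ℕ × ℕ => E p.1 p.2) (hT : SemiDec fun p : ℕ × ℕ => T p.1 p.2) :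
    SemiDec fun B => ∃ c, PositivityCertificate s F E T B c := by
  have h1 : SemiDec fun p : ℕ × ℕ × ℕ × ℕ × List ℕ => T p.2.1 p.2.2.1 :=
    hT.comp (f := fun p : ℕ × ℕ × ℕ × ℕ × List ℕ => (p.2.1, p.2.2.1))
      ((Primrec.fst.comp Primrec.snd).pair (Primrec.fst.comp (Primrec.snd.comp Primrec.snd)))
  have h2 : SemiDec fun q : (ℕ × ℕ × ℕ × ℕ × List ℕ) × ℕ =>
      s q.2 ∈ innerInter s (ballConstraints E q.1.1 q.1.2.2.1) ((1 / 2) ^ q.1.2.2.2.1) :=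
    (semiDec_mem_innerInter hs hE).comp
      (f := fun q : (ℕ × ℕ × ℕ × ℕ × List ℕ) × ℕ => (q.2, q.1.1, q.1.2.2.1, q.1.2.2.2.1))
      (Primrec.snd.pair ((Primrec.fst.comp Primrec.fst).pair
        ((Primrec.fst.comp (Primrec.snd.comp (Primrec.snd.comp Primrec.fst))).pair
          (Primrec.fst.comp (Primrec.snd.comp (Primrec.snd.comp (Primrec.snd.comp
            Primrec.fst)))))))
  have h3 := SemiDec.forall_mem (P := fun (p : ℕ × ℕ × ℕ × ℕ × List ℕ) i =>
      s i ∈ innerInter s (ballConstraints E p.1 p.2.2.1) ((1 / 2) ^ p.2.2.2.1)) h2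
    (f := fun p => p.2.2.2.2)
    (Primrec.snd.comp (Primrec.snd.comp (Primrec.snd.comp Primrec.snd)))
  have h4 : SemiDec fun p : ℕ × ℕ × ℕ × ℕ × List ℕ =>
      (1 / 2 : ℝ) ^ p.2.1 + (1 / 2) ^ p.2.2.2.1
        < rat (weightOn p.2.2.2.2 (F (p.2.2.2.1 + 1))) :=
    (semiDec_lt_weightOn hF).comp Primrec.snd
  exact SemiDec.exists (P := PositivityCertificate s F E T) (h1.and (h3.and h4))

/-- `B'` is formally included in `B` and in one of the ideal balls making up the `n`-th open set,
and its radius is at most `2⁻ⁿ`. -/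
def Refines (s : ℕ → X) (E : ℕ → ℕ → Prop) (n B B' : ℕ) : Prop :=
  dist (s B'.unpair.1) (s B.unpair.1) + posRat B'.unpair.2 < posRat B.unpair.2 ∧
    posRat B'.unpair.2 < (1 / 2 : ℚ) ^ n ∧
    ∃ b, E n b ∧ dist (s B'.unpair.1) (s b.unpair.1) + posRat B'.unpair.2 < posRat b.unpair.2

theorem semiDec_refines (hs : IsComputableMetricSpace s)
    (hE : SemiDec fun p : ℕ × ℕ => E p.1 p.2) :
    SemiDec fun p : (ℕ × ℕ) × ℕ => Refines s E p.1.1 p.1.2 p.2 := by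
  have h : SemiDec fun p : ℕ × ℕ =>
      dist (s p.1.unpair.1) (s p.2.unpair.1) + rat (ratOfPosRat p.1.unpair.2)
        < (posRat p.2.unpair.2 : ℝ) :=
    hs.semiDec_dist_add_lt.comp
      (f := fun p : ℕ × ℕ => (p.1.unpair.1, ratOfPosRat p.1.unpair.2, p.2))
      ((primrec_fst_unpair.comp Primrec.fst).pair ((primrec_ratOfPosRat.comp
        (primrec_snd_unpair.comp Primrec.fst)).pair Primrec.snd))
  have h1 := h.comp (f := fun p : (ℕ × ℕ) × ℕ => (p.2, p.1.2))
    (Primrec.snd.pair (Primrec.snd.comp Primrec.fst))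
  have h2 : SemiDec fun p : (ℕ × ℕ) × ℕ =>
      rat (ratOfPosRat p.2.unpair.2) < rat (ratHalfPow p.1.1) :=
    (primrecRel_rat_lt.comp
      (primrec_ratOfPosRat.comp (primrec_snd_unpair.comp Primrec.snd))
      (primrec_ratHalfPow.comp (Primrec.fst.comp Primrec.fst))).semiDec
  have h3 := h.comp (f := fun q : ((ℕ × ℕ) × ℕ) × ℕ => (q.1.2, q.2))
    ((Primrec.snd.comp Primrec.fst).pair Primrec.snd)
  have h4 : SemiDec fun q : ((ℕ × ℕ) × ℕ) × ℕ => E q.1.1.1 q.2 :=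
    hE.comp (f := fun q : ((ℕ × ℕ) × ℕ) × ℕ => (q.1.1.1, q.2))
      ((Primrec.fst.comp (Primrec.fst.comp Primrec.fst)).pair Primrec.snd)
  have h5 := SemiDec.exists (P := fun (p : (ℕ × ℕ) × ℕ) b => E p.1.1 b ∧
    dist (s p.2.unpair.1) (s b.unpair.1) + rat (ratOfPosRat p.2.unpair.2)
      < (posRat b.unpair.2 : ℝ)) (h4.and h3)
  refine (h1.and (h2.and h5)).of_eq fun p => ?_
  simp only [Refines, rat_ratOfPosRat, rat_ratHalfPow]

theorem exists_refines_mem (hs : DenseRange s) {n B : ℕ} {x : X} (hx : x ∈ idealBall s B)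
    (hxE : ∃ b, E n b ∧ x ∈ idealBall s b) : ∃ B', Refines s E n B B' ∧ x ∈ idealBall s B' := by
  obtain ⟨b, hb, hxb⟩ := hxE
  rw [idealBall, Metric.mem_ball] at hx hxb
  -- The new centre is within `q` of `x` and the new radius is `q`, so each formal inclusion
  -- consumes `2 * q` of the room around `x`.
  obtain ⟨q, hq0, hq⟩ := exists_rat_btwn (show (0 : ℝ) < min ((1 / 2) ^ n)
    (min ((posRat B.unpair.2 - dist x (s B.unpair.1)) / 2)
      ((posRat b.unpair.2 - dist x (s b.unpair.1)) / 2)) from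
    lt_min (by positivity) (lt_min (by linarith) (by linarith)))
  obtain ⟨hq1, hq2, hq3⟩ : (q : ℝ) < (1 / 2) ^ n ∧ _ ∧ _ := by simpa only [lt_min_iff] using hq
  obtain ⟨k, rfl⟩ := exists_posRat_eq (Rat.cast_pos.1 hq0)
  obtain ⟨i, hi⟩ := hs.exists_dist_lt x hq0
  refine ⟨Nat.pair i k, ⟨?_, ?_, b, hb, ?_⟩, ?_⟩
  · simp only [Nat.unpair_pair]
    linarith [dist_triangle_left (s i) (s B.unpair.1) x]
  · simp only [Nat.unpair_pair]
    rw [← Rat.cast_lt (K := ℝ)]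
    push_cast
    exact hq1
  · simp only [Nat.unpair_pair]
    linarith [dist_triangle_left (s i) (s b.unpair.1) x]
  · simpa [idealBall] using hi

variable [MeasurableSpace X] [BorelSpace X] {μ : Measure X} {G : ℕ → Set X}

/-- If `B` keeps measure greater than `2⁻ⁿ` in the first `N` sets, the others, removing at most
`2⁻ⁿ`, cannot exhaust it. Conversely, a positive measure exceeds some `2⁻ⁿ`, and so does the measure
of each larger finite intersection. -/
theorem exists_certificate_iff (hF : ∀ n, IsIdealMeasureName (F n) ∧
    levyProkhorovEDist (idealMeasure s (F n)) μ ≤ (2⁻¹ : ℝ≥0∞) ^ n)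
    (hG : ∀ j, G j = ⋃ b ∈ {b | E j b}, idealBall s b)
    (hT : ∀ n N, T n N → μ (⋃ j ≥ N, (G j)ᶜ) ≤ ENNReal.ofReal ((1 / 2) ^ n))
    (hT_ex : ∀ n, ∃ N, T n N) (B : ℕ) :
    (∃ c, PositivityCertificate s F E T B c) ↔ 0 < μ (idealBall s B ∩ ⋂ j, G j) := by
  have hO : ∀ N, innerInter s (ballConstraints E B N) 0 = idealBall s B ∩ ⋂ j < N, G j := by
    intro N
    rw [innerInter_ballConstraints_zero]
    simp only [hG]
  constructor
  · rintro ⟨⟨n, N, m, S⟩, hN, hS, hlt⟩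
    have h1 := lt_measure_of_lt_weightOn hF (by positivity) hS hlt
    rw [hO] at h1
    have h2 : idealBall s B ∩ ⋂ j < N, G j
        ⊆ (idealBall s B ∩ ⋂ j, G j) ∪ ⋃ j ≥ N, (G j)ᶜ := by
      rintro x ⟨hxB, hx⟩
      by_cases h : x ∈ ⋃ j ≥ N, (G j)ᶜ
      · exact Or.inr h
      · refine Or.inl ⟨hxB, mem_iInter.2 fun j => ?_⟩
        simp only [mem_iUnion, not_exists, mem_compl_iff, not_not, mem_iInter] at h hx
        exact (lt_or_ge j N).elim (hx j) (h j)
    by_contra h0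
    rw [not_lt, nonpos_iff_eq_zero] at h0
    have h3 := (measure_mono h2).trans (measure_union_le (μ := μ) _ _)
    rw [h0, zero_add] at h3
    exact absurd (h1.trans_le h3) (hT n N hN).not_gt
  · intro h
    have h1 : Tendsto (fun n : ℕ => ENNReal.ofReal ((1 / 2 : ℝ) ^ n)) atTop (𝓝 0) := by
      simpa using ENNReal.tendsto_ofReal
        (tendsto_pow_atTop_nhds_zero_of_lt_one (by norm_num : (0 : ℝ) ≤ 1 / 2) (by norm_num))
    obtain ⟨n, hn⟩ := (h1.eventually_lt_const h).exists
    obtain ⟨N, hN⟩ := hT_ex n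
    have h2 : ENNReal.ofReal ((1 / 2 : ℝ) ^ n) < μ (innerInter s (ballConstraints E B N) 0) := by
      rw [hO]
      exact hn.trans_le (measure_mono (inter_subset_inter_right _ fun x hx =>
        mem_iInter₂.2 fun j _ => mem_iInter.1 hx j))
    obtain ⟨m, S, hS, hlt⟩ := exists_lt_weightOn_of_lt_measure hF (by positivity) h2
    exact ⟨⟨n, N, m, S⟩, hN, hS, hlt⟩

/-- An ideal ball with positive measure in an effectively large intersection of constructive open
sets contains a computable point of this intersection lying in the support. -/
theorem exists_computablePoint_mem_iInter [CompleteSpace X] (hs : IsComputableMetricSpace s)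
    (hμ : IsComputableMeasure s μ) (hE : SemiDec fun p : ℕ × ℕ => E p.1 p.2)
    (hG : ∀ j, G j = ⋃ b ∈ {b | E j b}, idealBall s b)
    (hT_dec : SemiDec fun p : ℕ × ℕ => T p.1 p.2)
    (hT : ∀ n N, T n N → μ (⋃ j ≥ N, (G j)ᶜ) ≤ ENNReal.ofReal ((1 / 2) ^ n))
    (hT_ex : ∀ n, ∃ N, T n N) {B : ℕ} (hB : 0 < μ (idealBall s B ∩ ⋂ j, G j)) :
    ∃ x ∈ idealBall s B, IsComputablePoint s x ∧ x ∈ ⋂ j, G j ∧ x ∈ μ.support := by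
  obtain ⟨F, hFc, hF⟩ := hμ
  have hcert := exists_certificate_iff hF hG hT hT_ex
  have hQ : SemiDec fun p : (ℕ × ℕ) × ℕ => Refines s E p.1.1 p.1.2 p.2 ∧
      0 < μ (idealBall s p.2 ∩ ⋂ j, G j) :=
    (semiDec_refines hs hE).and
      (((semiDec_exists_certificate hs hFc hE hT_dec).of_eq hcert).comp Primrec.snd)
  obtain ⟨h, hh, h0, hstep⟩ := SemiDec.exists_computable_seq
    (Q := fun p B' => Refines s E p.1 p.2 B' ∧ 0 < μ (idealBall s B' ∩ ⋂ j, G j)) hQ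
    (P := fun B => 0 < μ (idealBall s B ∩ ⋂ j, G j)) (fun n B hB => by
      -- Otherwise the countably many refinements, which cover `idealBall s B ∩ ⋂ j, G j`, would all
      -- meet `⋂ j, G j` in null sets.
      by_contra! hcon
      refine hB.ne' (measure_mono_null (t := ⋃ B' ∈ {B' | Refines s E n B B'},
        (idealBall s B' ∩ ⋂ j, G j)) ?_ ?_)
      · rintro x ⟨hxB, hx⟩
        have hxn := mem_iInter.1 hx n
        rw [hG] at hxn
        obtain ⟨b, hb, hxb⟩ := mem_iUnion₂.1 hxn
        obtain ⟨B', hB', hxB'⟩ := exists_refines_mem hs.dense hxB ⟨b, hb, hxb⟩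
        exact mem_iUnion₂.2 ⟨B', hB', hxB', hx⟩
      · exact (measure_biUnion_null_iff (to_countable _)).2 fun B' hB' =>
          nonpos_iff_eq_zero.1 (hcon B' hB')) (fun n B B' h => h.2) hB
  have hpos : ∀ n, 0 < μ (idealBall s (h n)) := by
    intro n
    cases n with
    | zero => rw [h0]; exact hB.trans_le (measure_mono inter_subset_left)
    | succ n => exact (hstep n).2.trans_le (measure_mono inter_subset_left)
  let c : ℕ → X := fun n => s (h n).unpair.1
  let r : ℕ → ℝ := fun n => posRat (h n).unpair.2
  have hr0 : ∀ n, 0 < r n := fun n => Rat.cast_pos.2 (posRat_pos _)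
  have hr : ∀ n, r (n + 1) < (1 / 2) ^ n := fun n => by
    have := (Rat.cast_lt (K := ℝ)).2 (hstep n).1.2.1
    push_cast at this
    exact this
  have hnest : ∀ n k, dist (c (n + k)) (c n) + r (n + k) ≤ r n := by
    intro n k
    induction k with
    | zero => simp
    | succ k ih =>
      have h1 : dist (c (n + k + 1)) (c (n + k)) + r (n + k + 1) < r (n + k) :=
        (hstep (n + k)).1.1
      have h2 := dist_triangle (c (n + k + 1)) (c (n + k)) (c n)
      rw [← add_assoc]
      linarith
  have hrlim : Tendsto (fun n => r (n + 1)) atTop (𝓝 0) :=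
    squeeze_zero (fun n => (hr0 _).le) (fun n => (hr n).le)
      (tendsto_pow_atTop_nhds_zero_of_lt_one (by norm_num) (by norm_num))
  have hcauchy : CauchySeq c := by
    refine cauchySeq_of_le_tendsto_0' r (fun n m hnm => ?_)
      ((tendsto_add_atTop_iff_nat 1).1 hrlim)
    obtain ⟨k, rfl⟩ := Nat.exists_eq_add_of_le hnm
    rw [dist_comm]
    linarith [hnest n k, hr0 (n + k)]
  obtain ⟨x, hx⟩ := cauchySeq_tendsto_of_complete hcauchy
  have hdist : ∀ n, dist x (c n) ≤ r n := by
    intro n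
    refine le_of_tendsto ((tendsto_add_atTop_iff_nat n).2 hx |>.dist tendsto_const_nhds)
      (Eventually.of_forall fun k => ?_)
    rw [add_comm k n]
    linarith [hnest n k, hr0 (n + k)]
  refine ⟨x, ?_, ⟨fun n => (h (n + 1)).unpair.1, ?_, fun n => ?_⟩, ?_, ?_⟩
  -- The limit is only in the closed balls; strictness of the formal inclusion puts it in the open
  -- ball.
  · have h1 : dist (c 1) (c 0) + r 1 < r 0 := (hstep 0).1.1
    have h2 : dist x (c 0) < r 0 := by linarith [hdist 1, dist_triangle x (c 1) (c 0)]
    rw [← h0]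
    exact h2
  · exact Computable.fst.comp (Computable.unpair.comp (hh.comp Computable.succ))
  · rw [dist_comm]
    exact (hdist (n + 1)).trans (hr n).le
  · refine mem_iInter.2 fun n => ?_
    obtain ⟨b, hb, h1⟩ := (hstep n).1.2.2
    rw [hG]
    refine mem_iUnion₂.2 ⟨b, hb, ?_⟩
    have h2 : dist x (s b.unpair.1) < posRat b.unpair.2 := by
      have h3 : dist (c (n + 1)) (s b.unpair.1) + r (n + 1) < posRat b.unpair.2 := h1
      linarith [hdist (n + 1), dist_triangle x (c (n + 1)) (s b.unpair.1)]
    exact h2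
  -- Every neighbourhood of `x` contains one of the shrinking balls, which have positive measure.
  · refine (Measure.mem_support_iff_forall x).2 fun U hU => ?_
    obtain ⟨ε, hε, hεU⟩ := Metric.mem_nhds_iff.1 hU
    obtain ⟨n, hn⟩ := (hrlim.eventually_lt_const (half_pos hε)).exists
    refine (hpos (n + 1)).trans_le (measure_mono (Subset.trans (fun y hy => ?_) hεU))
    have h1 : dist y (c (n + 1)) < r (n + 1) := hy
    rw [Metric.mem_ball]
    linarith [hdist (n + 1), dist_triangle_right y x (c (n + 1))]

end Core

/-! ### Uniform families of Borel-Cantelli sequences -/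

section BorelCantelli

variable {X : Type*} [MeasurableSpace X] {μ : Measure X}
  {U : ℕ → ℕ → Set X} {A : ℕ → ℕ → ℕ}

/-- The `i`-th sequence gets the budget `2⁻⁽ⁿ⁺ⁱ⁺¹⁾`, and these sum to `2⁻ⁿ`. -/
theorem measure_iUnion_tails_le
    (hA : ∀ i e, ∑' k, μ (U i (A i e + k))ᶜ ≤ ENNReal.ofReal (posRat e : ℝ)) (n : ℕ) (e : ℕ → ℕ)
    (he : ∀ i, posRat (e i) ≤ (1 / 2) ^ (n + i + 1)) :
    μ (⋃ i, ⋃ k, (U i (A i (e i) + k))ᶜ) ≤ ENNReal.ofReal ((1 / 2) ^ n) := by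
  have h1 : ∀ i, μ (⋃ k, (U i (A i (e i) + k))ᶜ) ≤ (2⁻¹ : ℝ≥0∞) ^ n * 2⁻¹ ^ (i + 1) := by
    intro i
    refine (measure_iUnion_le _).trans ((hA i (e i)).trans ?_)
    rw [← pow_add, ← add_assoc, ← ofReal_half_pow]
    refine ENNReal.ofReal_le_ofReal ?_
    have := (Rat.cast_le (K := ℝ)).2 (he i)
    push_cast at this
    exact this
  refine (measure_iUnion_le _).trans ((ENNReal.tsum_le_tsum h1).trans ?_)
  rw [ENNReal.tsum_mul_left, ENNReal.tsum_geometric_add_one, ENNReal.one_sub_inv_two,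
    ENNReal.mul_inv_cancel (by simp) (by simp), mul_one, ofReal_half_pow]

theorem half_pow_le_half_pow {m n : ℕ} (h : m ≤ n) : (1 / 2 : ℚ) ^ n ≤ (1 / 2) ^ m :=
  pow_le_pow_of_le_one (by norm_num) (by norm_num) h

/-- The index from which the `i`-th sequence is used, so that all complements together have measure
at most `2⁻ᶜ`. -/
def tailStart (A : ℕ → ℕ → ℕ) (c i : ℕ) : ℕ := A i (posRatHalfPow (2 * i + 1 + c))

/-- The tails of all the sequences, arranged in a single sequence. -/
def flattenTails (U : ℕ → ℕ → Set X) (A : ℕ → ℕ → ℕ) (c j : ℕ) : Set X :=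
  U j.unpair.1 (tailStart A c j.unpair.1 + j.unpair.2)

theorem computable_tailStart (hA : Computable₂ A) (c : ℕ) : Computable (tailStart A c) :=
  hA.comp Computable.id (primrec_posRatHalfPow.comp (Primrec.nat_add.comp
    Primrec.nat_double_succ (Primrec.const c))).to_comp

theorem measure_iUnion_compl_flattenTails_le
    (hA : ∀ i e, ∑' k, μ (U i (A i e + k))ᶜ ≤ ENNReal.ofReal (posRat e : ℝ)) (c : ℕ) :
    μ (⋃ j, (flattenTails U A c j)ᶜ) ≤ ENNReal.ofReal ((1 / 2) ^ c) := by
  refine (measure_mono ?_).trans (measure_iUnion_tails_le hA c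
    (fun i => posRatHalfPow (2 * i + 1 + c)) fun i => ?_)
  · exact iUnion_subset fun j => subset_iUnion₂_of_subset j.unpair.1 j.unpair.2 Subset.rfl
  · rw [posRat_posRatHalfPow]
    exact half_pow_le_half_pow (by omega)

/-- For `i < n`, positions beyond `N` lie far enough out in the `i`-th sequence, as pairing is
increasing in its second argument. For `i ≥ n` the whole tail already fits the budget, since `2 * i
+ 1 + c ≥ n + i + 1`; this is the purpose of the `2 * i` in `tailStart`. Thus only finitely many
sequences constrain `N`. -/
theorem measure_tail_flattenTails_le
    (hA : ∀ i e, ∑' k, μ (U i (A i e + k))ᶜ ≤ ENNReal.ofReal (posRat e : ℝ)) {c n N : ℕ}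
    (hN : ∀ i < n, Nat.pair i (A i (posRatHalfPow (n + i + 1))) ≤ N) :
    μ (⋃ j ≥ N, (flattenTails U A c j)ᶜ) ≤ ENNReal.ofReal ((1 / 2) ^ n) := by
  refine (measure_mono ?_).trans (measure_iUnion_tails_le hA n
    (fun i => if i < n then posRatHalfPow (n + i + 1) else posRatHalfPow (2 * i + 1 + c))
    fun i => ?_)
  · refine iUnion₂_subset fun j hj => ?_
    by_cases hi : j.unpair.1 < n
    · have hk : A j.unpair.1 (posRatHalfPow (n + j.unpair.1 + 1)) ≤ j.unpair.2 := by
        by_contra! hlt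
        have h1 := Nat.pair_lt_pair_right j.unpair.1 hlt
        rw [Nat.pair_unpair] at h1
        exact absurd (h1.trans_le (hN _ hi)) (not_lt.2 hj)
      obtain ⟨d, hd⟩ := Nat.exists_eq_add_of_le hk
      refine subset_iUnion₂_of_subset j.unpair.1 (tailStart A c j.unpair.1 + d) ?_
      rw [if_pos hi, flattenTails, hd, Nat.add_left_comm]
    · refine subset_iUnion₂_of_subset j.unpair.1 j.unpair.2 ?_
      rw [if_neg hi]
      exact Subset.rfl
  · split_ifs with hi <;> rw [posRat_posRatHalfPow]
    exact half_pow_le_half_pow (by omega)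

theorem semiDec_tail_bound (hA : Computable₂ A) : SemiDec fun p : ℕ × ℕ =>
    ∀ i < p.1, Nat.pair i (A i (posRatHalfPow (p.1 + i + 1))) ≤ p.2 := by
  have he : Primrec fun q : (ℕ × ℕ) × ℕ => posRatHalfPow (q.1.1 + q.2 + 1) :=
    primrec_posRatHalfPow.comp (Primrec.succ.comp
      (Primrec.nat_add.comp (Primrec.fst.comp Primrec.fst) Primrec.snd))
  have hf : Computable fun q : (ℕ × ℕ) × ℕ =>
      (Nat.pair q.2 (A q.2 (posRatHalfPow (q.1.1 + q.2 + 1))), q.1.2) :=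
    (Primrec₂.natPair.to_comp.comp Computable.snd (hA.comp Computable.snd he.to_comp)).pair
      (Computable.snd.comp Computable.fst)
  have h1 : SemiDec fun p : ℕ × ℕ => p.1 ≤ p.2 := Primrec.nat_le.semiDec
  exact SemiDec.forall_lt (P := fun (p : ℕ × ℕ) i =>
    Nat.pair i (A i (posRatHalfPow (p.1 + i + 1))) ≤ p.2) (h1.comp_computable hf) Primrec.fst

end BorelCantelli

end CompMetric

/-! ### Density of the computable points -/

open CompMetric

theorem mainTheorem8 {X : Type*} [MetricSpace X] [CompleteSpace X]
    [MeasurableSpace X] [BorelSpace X]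
    (s : ℕ → X) (hs : CompMetric.IsComputableMetricSpace s)
    (μ : Measure X) [IsProbabilityMeasure μ] (hμ : CompMetric.IsComputableMeasure s μ)
    (R : ℕ → Set X) (hR : CompMetric.UniformBorelCantelliSets s μ R) :
    μ.support ⊆ closure ({x | CompMetric.IsComputablePoint s x ∧ x ∈ ⋂ i, R i} ∩ μ.support) := by
  obtain ⟨U, ⟨⟨φ, hφ, hU⟩, ⟨A, hA, hAsum⟩⟩, hRU⟩ := hR
  intro x₀ hx₀
  refine Metric.mem_closure_iff.2 fun ε hε => ?_
  -- With radius less than `ε / 2`, a ball containing `x₀` lies within `ε` of `x₀`.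
  obtain ⟨q, hq0, hqε⟩ := exists_rat_btwn (half_pos hε)
  obtain ⟨r, rfl⟩ := exists_posRat_eq (Rat.cast_pos.1 hq0)
  obtain ⟨i₀, hi₀⟩ := hs.dense.exists_dist_lt x₀ hq0
  let B := Nat.pair i₀ r
  have hBall : idealBall s B = Metric.ball (s i₀) (posRat r) := by simp [B, idealBall]
  have hBpos : 0 < μ (idealBall s B) := by
    rw [hBall]
    exact (Measure.mem_support_iff_forall x₀).1 hx₀ _ (Metric.isOpen_ball.mem_nhds hi₀)
  obtain ⟨c, hc⟩ : ∃ c : ℕ, ENNReal.ofReal ((1 / 2 : ℝ) ^ c) < μ (idealBall s B) := by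
    simp only [ofReal_half_pow]
    exact ENNReal.exists_inv_two_pow_lt hBpos.ne'
  -- The removed complements have total measure at most `2⁻ᶜ`, less than that of the ball.
  have hpos : 0 < μ (idealBall s B ∩ ⋂ j, flattenTails U A c j) := by
    by_contra h0
    rw [not_lt, nonpos_iff_eq_zero] at h0
    have h1 : idealBall s B ⊆ (idealBall s B ∩ ⋂ j, flattenTails U A c j)
        ∪ ⋃ j, (flattenTails U A c j)ᶜ := by
      intro x hx
      rw [← compl_iInter]
      by_cases h : x ∈ ⋂ j, flattenTails U A c j
      · exact Or.inl ⟨hx, h⟩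
      · exact Or.inr h
    have h2 := (measure_mono h1).trans (measure_union_le (μ := μ) _ _)
    rw [h0, zero_add] at h2
    exact absurd (hc.trans_le h2) (measure_iUnion_compl_flattenTails_le hAsum c).not_gt
  have hf : Computable fun q : ((ℕ × ℕ) × ℕ) =>
      ((q.1.1.unpair.1, tailStart A c q.1.1.unpair.1 + q.1.1.unpair.2), q.2) := by
    have hj : Primrec fun q : (ℕ × ℕ) × ℕ => q.1.1 := Primrec.fst.comp Primrec.fst
    have h1 := (primrec_fst_unpair.comp hj).to_comp
    exact (h1.pair (Primrec.nat_add.to_comp.comp ((computable_tailStart hA c).comp h1)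
      (primrec_snd_unpair.comp hj).to_comp)).pair Computable.snd
  have hE : SemiDec fun p : ℕ × ℕ => ∃ n,
      p.2 ∈ φ (p.1.unpair.1, tailStart A c p.1.unpair.1 + p.1.unpair.2) n := by
    have h1 : SemiDec fun p : ((ℕ × ℕ) × ℕ) × ℕ => p.2 ∈ φ p.1.1 p.1.2 := Partrec.semiDec_mem hφ
    have h2 := h1.comp_computable (hf.pair (Computable.snd.comp Computable.fst))
    exact SemiDec.exists (P := fun (p : ℕ × ℕ) n =>
      p.2 ∈ φ (p.1.unpair.1, tailStart A c p.1.unpair.1 + p.1.unpair.2) n) h2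
  obtain ⟨x, hxB, hxc, hxG, hxμ⟩ := exists_computablePoint_mem_iInter (s := s) (μ := μ)
    (G := flattenTails U A c)
    (E := fun j b => ∃ n, b ∈ φ (j.unpair.1, tailStart A c j.unpair.1 + j.unpair.2) n)
    (T := fun n N => ∀ i < n, Nat.pair i (A i (posRatHalfPow (n + i + 1))) ≤ N)
    hs hμ hE (fun j => by
      have h1 := hU (j.unpair.1, tailStart A c j.unpair.1 + j.unpair.2)
      refine h1.trans ?_
      ext y
      simp only [mem_iUnion, mem_ofPred_eq, exists_prop]
      exact ⟨fun ⟨n, b, hb, hy⟩ => ⟨b, ⟨n, hb⟩, hy⟩, fun ⟨b, ⟨n, hb⟩, hy⟩ => ⟨n, b, hb, hy⟩⟩)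
    (semiDec_tail_bound hA) (fun n N hN => measure_tail_flattenTails_le hAsum hN)
    (fun n => by
      obtain ⟨N, hN⟩ := ((finite_Iio n).image fun i =>
        Nat.pair i (A i (posRatHalfPow (n + i + 1)))).bddAbove
      exact ⟨N, fun i hi => hN (mem_image_of_mem _ hi)⟩) hpos
  refine ⟨x, ⟨⟨hxc, mem_iInter.2 fun i => ?_⟩, hxμ⟩, ?_⟩
  · rw [hRU]
    -- `U i n` with `n` past the cut is the entry of the flattened sequence at the pair of `i` and
    -- the offset from the cut.
    refine mem_iUnion.2 ⟨tailStart A c i, mem_iInter₂.2 fun n hn => ?_⟩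
    have h1 := mem_iInter.1 hxG (Nat.pair i (n - tailStart A c i))
    simpa only [flattenTails, Nat.unpair_pair, Nat.add_sub_cancel' hn] using h1
  · rw [hBall, Metric.mem_ball] at hxB
    linarith [dist_triangle_right x₀ x (s i₀)]
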